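/- Let $k\ge 1$, let $M_k=\{e_1,\dots,e_k,f_1,\dots,f_k\}$ be a set of markers, and let the Rabin language $\mathcal R_k\subseteq (2^{M_k})^\omega$ be the set of words $\alpha_0\alpha_1\alpha_2\cdots$ for which there is a $j$ such that $e_j\in\alpha_i$ for infinitely many $i$ and $f_j\in\alpha_i$ for only finitely many $i$. A (partially observable) Markov chain over a set $\Sigma$ of observations has a finite state set $S$, an initial state $s_{in}$, an observation function $\mathrm{Obs}:S\to\Sigma$ and a transition probability matrix. A black-box strategy is a function $\sigma:(\Sigma\times\{r,c\})^*\Sigma\to\{r,c\}$ that chooses, from the observations and actions so far, whether to restart ($r$: the chain is put back into $s_{in}$) or to continue ($c$: the chain makes one step). Together with a Markov chain $\mathcal M$ it induces a Markov chain on the finite histories $(S\times\{r,c\})^*\times S$. If a run of the induced chain has finitely many restarts, its tail is the infinite sequence of observations made from the last restart on (from the beginning if there is no restart). The strategy $\sigma$ is a testing strategy for a language $L\subseteq\Sigma^\omega$ if for every finite Markov chain $\mathcal M$ over $\Sigma$ such that the observation sequence of a run of $\mathcal M$ lies in $L$ with positive probability, with probability 1 a run of the chain induced by $\sigma$ and $\mathcal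 M$ has finitely many restarts and its tail belongs to $L$. The length of a finite path $\pi=s_0\cdots s_m$ is $m$, and its second half is $s_{\lceil m/2\rceil}\cdots s_m$. A finite path over $2^{M_k}$ is good if it has length $0$, or if for some $1\le i\le k$ some state of the path has $e_i$ in its observation and no state of the path has $f_i$ in its observation. For $f:\mathbb N\to\mathbb N$, the strategy $\mathfrak S[f]$ over $2^{M_k}$ does the following after the $n$-th restart ($n=0$ at the beginning): it samples the chain in blocks of $2f(n)$ steps; whenever the path $\pi$ sampled since the $n$-th restart consists of complete blocks, it restarts if the second half of $\pi$ is not good, and otherwise it samples another block. (If $f(n)=0$, so that the blocks are empty, it restarts immediately.) Theorem. For every $k\ge1$ and every $f:\mathbb N\to\mathbb N$, the strategy $\mathfrak S[f]$ is a testing strategy for $\mathcal R_k$ if and only if $\limsup_{n\to\infty}f(n)=\infty$. -/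

import Mathlib

noncomputable section

namespace BlackBoxTesting

/-! ### Partially observable Markov chains -/

/-- A Markov chain with state set `S`, initial state `init`, observation function `obs` into `O`,
and a transition probability distribution `P s` for every state `s`.  Finiteness of `S` is imposed
where it is wanted, since a strategy turns a finite MDP into a chain with infinitely many states. -/
structure MarkovChain (O S : Type) where
  init : S
  obs : S → O
  P : S → PMF S

namespace MarkovChain

variable {O S : Type}

/-- The σ-algebra on infinite state sequences that is generated by the cones: the product of the
discrete σ-algebras. -/
abbrev seqSpace (S : Type) : MeasurableSpace (ℕ → S) :=
  @MeasurableSpace.pi ℕ (fun _ => S) (fun _ => ⊤)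

/-- The kernel that samples state number `n + 1` from the states number `0, …, n`. -/
def stepKernel (M : MarkovChain O S) (n : ℕ) :
    @ProbabilityTheory.Kernel ((i : Finset.Iic n) → S) S
      (@MeasurableSpace.pi _ (fun _ => S) (fun _ => ⊤)) ⊤ :=
  letI : MeasurableSpace S := ⊤
  { toFun := fun h => (M.P (h ⟨n, Finset.mem_Iic.2 le_rfl⟩)).toMeasure
    measurable' :=
      (measurable_from_top (f := fun s : S => (M.P s).toMeasure)).comp (measurable_pi_apply _) }

/-- The law of the infinite sequence of states visited by the chain: the sequence starts in the
initial state, and every next state is drawn from the transition distribution of the last one. -/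
def law (M : MarkovChain O S) : @MeasureTheory.Measure (ℕ → S) (seqSpace S) :=
  letI : MeasurableSpace S := ⊤
  haveI : ∀ n, ProbabilityTheory.IsMarkovKernel (M.stepKernel n) := fun n =>
    ⟨fun h => PMF.toMeasure.isProbabilityMeasure (M.P (h ⟨n, Finset.mem_Iic.2 le_rfl⟩))⟩
  ProbabilityTheory.Kernel.traj (X := fun _ => S) M.stepKernel 0 (fun _ => M.init)

/-- The observation associated to an infinite sequence of states. -/
def obsSeq (M : MarkovChain O S) (ρ : ℕ → S) : ℕ → O := fun i => M.obs (ρ i)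

/-- The probability that the observation of a run of the chain belongs to `L`. -/
def prob (M : MarkovChain O S) (L : Set (ℕ → O)) : ENNReal := M.law {ρ | M.obsSeq ρ ∈ L}

end MarkovChain

/-! ### Partially observable Markov decision processes and strategies -/

/-- A Markov decision process with states `S`, observations `O` and actions `A`. -/
structure MDP (O A S : Type) where
  init : S
  obs : S → O
  Δ : S → A → PMF S

/-- A strategy maps `(O × A)* O` to `A`: the first argument is the list of the previous observations
with the actions taken there, the second one is the current observation. -/
abbrev Strategy (O A : Type) := List (O × A) → O → A

/-- The states of the chain that a strategy induces: the finite paths `(S × A)* × S`. -/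
abbrev Hist (S A : Type) := List (S × A) × S

namespace MDP

variable {O A S : Type}

/-- The action that the strategy chooses after the path `π`, of which it sees the observations. -/
def choice (M : MDP O A S) (σ : Strategy O A) (π : Hist S A) : A :=
  σ (π.1.map fun x => (M.obs x.1, x.2)) (M.obs π.2)

/-- The Markov chain induced by a strategy: the path `π` is extended by the action `a` that the
strategy chooses and by a successor drawn from the distribution of `a`. -/
def induced (M : MDP O A S) (σ : Strategy O A) : MarkovChain O (Hist S A) where
  init := ([], M.init)
  obs π := M.obs π.2
  P π := (M.Δ π.2 (M.choice σ π)).map fun s' => (π.1 ++ [(π.2, M.choice σ π)], s')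

end MDP

/-! ### Testing strategies -/

/-- The actions `r` (restart) and `c` (continue). -/
inductive Action
  | r
  | c
  deriving DecidableEq

/-- The restart MDP of a Markov chain. -/
def MarkovChain.restartMDP {O S : Type} (M : MarkovChain O S) : MDP O Action S where
  init := M.init
  obs := M.obs
  Δ s a := match a with
    | .r => PMF.pure M.init
    | .c => M.P s

/-- The steps `t` of a run of the induced chain at which the action is `r`, that is, at which the
path number `t + 1` is obtained from the path number `t` by appending `r` and a state. -/
def restartSteps {S : Type} (ρ : ℕ → Hist S Action) : Set ℕ :=
  {t | ∃ s, (ρ (t + 1)).1.getLast? = some (s, Action.r)}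

/-- The number of restarts. -/
def numRestarts {S : Type} (ρ : ℕ → Hist S Action) : ℕ∞ := (restartSteps ρ).encard

/-- For a run with finitely many restarts, the index of the first path that ends after the last
restart, and `0` if there is no restart. -/
def tailStart {S : Type} (ρ : ℕ → Hist S Action) : ℕ := sSup {t | ∃ u ∈ restartSteps ρ, t = u + 1}

/-- For a run with finitely many restarts, the observations from the last restart on. -/
def MarkovChain.tail {O S : Type} (M : MarkovChain O S) (ρ : ℕ → Hist S Action) : ℕ → O :=
  fun i => M.obs (ρ (tailStart ρ + i)).2

/-- `σ` is a testing strategy for `L` if for every finite Markov chain `M` over the observations `O`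
that gives `L` positive probability, almost every run of the chain that `σ` induces on the restart
MDP of `M` has finitely many restarts and its tail belongs to `L`. -/
def IsTestingStrategy {O : Type} (σ : Strategy O Action) (L : Set (ℕ → O)) : Prop :=
  ∀ (S : Type) [Finite S] (M : MarkovChain O S), 0 < M.prob L →
    ∀ᵐ ρ ∂(M.restartMDP.induced σ).law, numRestarts ρ < ⊤ ∧ M.tail ρ ∈ L

/-! ### Rabin languages -/

/-- The markers `e₁, …, e_k, f₁, …, f_k`. -/
inductive Marker (k : ℕ)
  | e (i : Fin k)
  | f (i : Fin k)

/-- The Rabin language: for some `j`, the marker `e j` occurs infinitely often and the marker `f j`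
only finitely often. -/
def rabin (k : ℕ) : Set (ℕ → Set (Marker k)) :=
  {w | ∃ j, {i | Marker.e j ∈ w i}.Infinite ∧ {i | Marker.f j ∈ w i}.Finite}

/-! ### The strategy

A finite path `s₀ … s_m` is seen by the strategy as the list of its `m + 1` observations. -/

/-- The length `m` (number of steps) of the path `s₀ … s_m`. -/
def pathLength {O : Type} (w : List O) : ℕ := w.length - 1

/-- The second half `s_⌈m/2⌉ … s_m` of `s₀ … s_m`; here `⌈m/2⌉ = (m + 1) / 2`, rounded down. -/
def secondHalf {O : Type} (w : List O) : List O := w.drop ((pathLength w + 1) / 2)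

/-- A path is `i`-good if it has length `0`, or if it contains `e i` but not `f i`. -/
def IsGoodFor {k : ℕ} (i : Fin k) (w : List (Set (Marker k))) : Prop :=
  pathLength w = 0 ∨ ((∃ s ∈ w, Marker.e i ∈ s) ∧ ∀ s ∈ w, Marker.f i ∉ s)

/-- A path is good if it is `i`-good for some `i`. -/
def IsGood {k : ℕ} (w : List (Set (Marker k))) : Prop := ∃ i, IsGoodFor i w

/-- The number of restarts in a history. -/
def restartCount {O : Type} (h : List (O × Action)) : ℕ := (h.map Prod.snd).count Action.r

/-- The path sampled since the last restart: the observations after the last action `r` of the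
history, followed by the current observation. -/
def currentPath {O : Type} (h : List (O × Action)) (o : O) : List O :=
  (h.rtakeWhile fun x => x.2 = Action.c).map Prod.fst ++ [o]

open Classical in
/-- The strategy with parameter `f`.  After the `n`-th restart it samples blocks of `2 * f n` steps.
Whenever a number of complete blocks has been sampled, it restarts if the second half of the path
sampled since the `n`-th restart is not good.  If `f n = 0`, so that there is nothing to sample, it
passes on to the next restart at once. -/
def strategyS (k : ℕ) (f : ℕ → ℕ) : Strategy (Set (Marker k)) Action := fun h o =>
  if f (restartCount h) = 0 ∨
      (2 * f (restartCount h) ∣ pathLength (currentPath h o) ∧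
        ¬ IsGood (secondHalf (currentPath h o)))
  then Action.r else Action.c

end BlackBoxTesting

end

namespace BlackBoxTesting

open MeasureTheory ProbabilityTheory Filter Topology
open scoped ENNReal

attribute [local instance] MarkovChain.seqSpace

/-! In a finite chain, a closed set from which a target is always reachable forces visits to the
target in every window `[t, 2t]`, up to finitely many exceptions almost surely
(`ae_eventually_window`: geometric bound plus Borel–Cantelli). After `b` blocks of length `2F` the
sampled second half is exactly the window `[F b, 2 F b]`. Hence `ae_trichotomy`: for each pair `j`,
late windows all contain `e j` and no `f j`, or contain no `e j`, or all contain `f j`. Two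
consequences follow. A run whose checks all succeed is almost surely in the Rabin language
(`ae_rabin_of_goodBlocks`). If the Rabin language has positive probability, then for some `N` there
is a positive probability `p` that all checks succeed for every `F ≥ N` simultaneously
(`exists_law_goodBlocks_pos`).

Suppose `f` is unbounded. Infinitely many restarts would pass through infinitely many rounds with `f
n > N`, each of which is the last one with probability at least `p`; so almost surely there are
finitely many restarts. The last round passes all its checks, so its tail is in the Rabin language.
The link between the test process and `M` is `law_no_restart`: within a round, as long as nothing is
restarted, the process is a copy of `M`.

Suppose `f n < B` for all `n ≥ a`. A chain that must climb `2 B` steps before it shows any marker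
fails the first check of every round from `a` on. Round `a` is reached with positive probability by
staying at the bottom, so infinitely many restarts have positive probability, although the chain
satisfies the Rabin condition. -/

/-- Membership of a sequence in `A` is determined by its first `n + 1` terms. -/
def DependsUpTo {S : Type} (n : ℕ) (A : Set (ℕ → S)) : Prop :=
  ∀ ρ ρ' : ℕ → S, (∀ i ≤ n, ρ i = ρ' i) → ρ ∈ A → ρ' ∈ A

/-- The sequences that agree with `x` up to time `n`. -/
def cone {S : Type} (n : ℕ) (x : ℕ → S) : Set (ℕ → S) := {ρ | ∀ i ≤ n, ρ i = x i}

/-- The sequence with its first `b` terms removed. -/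
def shift {S : Type} (b : ℕ) (ρ : ℕ → S) : ℕ → S := fun i => ρ (b + i)

@[simp]
lemma shift_apply {S : Type} (b : ℕ) (ρ : ℕ → S) (i : ℕ) : shift b ρ i = ρ (b + i) := rfl

/-! ### Cones and uniqueness of measures on sequence space. -/

section PathSpace

variable {S : Type}

lemma measurableSet_coord (n : ℕ) (B : Set S) : MeasurableSet {ρ : ℕ → S | ρ n ∈ B} := by
  let _ : MeasurableSpace S := ⊤
  exact (measurable_pi_apply (X := fun _ : ℕ => S) n) (MeasurableSpace.measurableSet_top (s := B))

lemma measurableSet_cone (n : ℕ) (x : ℕ → S) : MeasurableSet (cone n x) := by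
  have : cone n x = ⋂ i ∈ Set.Iic n, {ρ : ℕ → S | ρ i ∈ ({x i} : Set S)} := by
    ext ρ; simp [cone]
  rw [this]
  exact MeasurableSet.biInter (Set.to_countable _) fun i _ => measurableSet_coord i _

lemma measurable_shift (b : ℕ) : Measurable (shift b : (ℕ → S) → ℕ → S) := by
  let _ : MeasurableSpace S := ⊤
  exact measurable_pi_lambda _ fun i => measurable_pi_apply _

lemma measurable_map_path {S' : Type} (φ : S → S') :
    Measurable (fun (ρ : ℕ → S) (i : ℕ) => φ (ρ i)) := by
  let _ : MeasurableSpace S := ⊤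
  let _ : MeasurableSpace S' := ⊤
  exact measurable_pi_lambda _ fun i => measurable_from_top.comp (measurable_pi_apply i)

lemma preimage_frestrictLe_singleton (n : ℕ) (x : ℕ → S) :
    Preorder.frestrictLe (π := fun _ => S) n ⁻¹' {Preorder.frestrictLe n x} = cone n x := by
  ext ρ
  simp [cone, funext_iff, Preorder.frestrictLe]

lemma DependsUpTo.preimage_image {n : ℕ} {A : Set (ℕ → S)} (hA : DependsUpTo n A) :
    Preorder.frestrictLe (π := fun _ => S) n ⁻¹' (Preorder.frestrictLe n '' A) = A := by
  refine Set.Subset.antisymm ?_ (Set.subset_preimage_image _ _)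
  rintro ρ ⟨x, hx, h⟩
  refine hA x ρ (fun i hi => ?_) hx
  exact congrFun h ⟨i, Finset.mem_Iic.2 hi⟩

lemma DependsUpTo.mono {n m : ℕ} (h : n ≤ m) {A : Set (ℕ → S)} (hA : DependsUpTo n A) :
    DependsUpTo m A := fun _ _ e => hA _ _ fun i hi => e i (hi.trans h)

lemma DependsUpTo.inter {n : ℕ} {A B : Set (ℕ → S)} (hA : DependsUpTo n A)
    (hB : DependsUpTo n B) : DependsUpTo n (A ∩ B) :=
  fun _ _ e h => ⟨hA _ _ e h.1, hB _ _ e h.2⟩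

lemma dependsUpTo_coord (n : ℕ) (B : Set S) : DependsUpTo n {ρ : ℕ → S | ρ n ∈ B} :=
  fun ρ ρ' e h => by simpa [← e n le_rfl] using h

lemma dependsUpTo_cone (n : ℕ) (x : ℕ → S) : DependsUpTo n (cone n x) :=
  fun _ _ e h i hi => (e i hi).symm.trans (h i hi)

lemma isPiSystem_dependsUpTo : IsPiSystem {A : Set (ℕ → S) | ∃ n, DependsUpTo n A} := by
  rintro A ⟨n, hA⟩ B ⟨m, hB⟩ -
  exact ⟨max n m, (hA.mono (le_max_left _ _)).inter (hB.mono (le_max_right _ _))⟩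

variable [Countable S]

lemma measurableSet_of_dependsUpTo {n : ℕ} {A : Set (ℕ → S)} (hA : DependsUpTo n A) :
    MeasurableSet A := by
  have : A = ⋃ y ∈ Preorder.frestrictLe (π := fun _ => S) n '' A,
      Preorder.frestrictLe (π := fun _ => S) n ⁻¹' {y} := by
    rw [← Set.preimage_iUnion₂, Set.biUnion_of_singleton, hA.preimage_image]
  rw [this]
  refine MeasurableSet.biUnion (Set.to_countable _) ?_
  rintro _ ⟨x, -, rfl⟩
  rw [preimage_frestrictLe_singleton]
  exact measurableSet_cone n x

/-- The level-`n` cones contained in `A` partition it, and there are only countably many of them. -/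
lemma measure_eq_of_dependsUpTo {μ ν : Measure (ℕ → S)} {n : ℕ} {A : Set (ℕ → S)}
    (hA : DependsUpTo n A) (h : ∀ x ∈ A, μ (cone n x) = ν (cone n x)) : μ A = ν A := by
  have key : ∀ η : Measure (ℕ → S), η A = ∑' b : Preorder.frestrictLe (π := fun _ => S) n '' A,
      η (Preorder.frestrictLe (π := fun _ => S) n ⁻¹' {b.1}) := fun η => by
    rw [tsum_measure_preimage_singleton (Set.to_countable _), hA.preimage_image]
    rintro _ ⟨x, -, rfl⟩
    rw [preimage_frestrictLe_singleton]
    exact measurableSet_cone n x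
  rw [key μ, key ν]
  refine tsum_congr ?_
  rintro ⟨_, x, hx, rfl⟩
  simpa only [preimage_frestrictLe_singleton] using h x hx

lemma generateFrom_dependsUpTo :
    MarkovChain.seqSpace S = MeasurableSpace.generateFrom {A | ∃ n, DependsUpTo n A} := by
  refine le_antisymm ?_ (MeasurableSpace.generateFrom_le ?_)
  · refine iSup_le fun n => ?_
    rintro _ ⟨B, -, rfl⟩
    exact MeasurableSpace.measurableSet_generateFrom ⟨n, dependsUpTo_coord n B⟩
  · rintro A ⟨n, hA⟩
    exact measurableSet_of_dependsUpTo hA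

/-- Two finite measures that agree on all cones inside `D` agree on `D`, if `D` is a decreasing
intersection of sets each of which is determined by finitely many terms. -/
lemma measure_inter_iInter_eq {μ ν : Measure (ℕ → S)} [IsFiniteMeasure μ] [IsFiniteMeasure ν]
    {D : ℕ → Set (ℕ → S)} (hD : ∀ n, DependsUpTo n (D n)) (hanti : Antitone D)
    (h : ∀ n, ∀ x ∈ D n, μ (cone n x) = ν (cone n x)) {A : Set (ℕ → S)} (hA : MeasurableSet A) :
    μ (A ∩ ⋂ n, D n) = ν (A ∩ ⋂ n, D n) := by
  have hDm : MeasurableSet (⋂ n, D n) :=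
    MeasurableSet.iInter fun n => measurableSet_of_dependsUpTo (hD n)
  have key : ∀ (n : ℕ) (A : Set (ℕ → S)), DependsUpTo n A →
      μ (A ∩ ⋂ n, D n) = ν (A ∩ ⋂ n, D n) := by
    intro n A hA
    have lim : ∀ (η : Measure (ℕ → S)) [IsFiniteMeasure η],
        Tendsto (fun m => η (A ∩ D m)) atTop (𝓝 (η (A ∩ ⋂ n, D n))) := by
      intro η _
      rw [Set.inter_iInter]
      exact tendsto_measure_iInter_atTop
        (fun m => ((measurableSet_of_dependsUpTo hA).inter
          (measurableSet_of_dependsUpTo (hD m))).nullMeasurableSet)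
        (fun i j hij => Set.inter_subset_inter_right _ (hanti hij))
        ⟨0, measure_ne_top _ _⟩
    -- For `m ≥ n` the set `A ∩ D m` is determined by the first `m + 1` terms and made of cones
    -- inside `D m`, so both measures agree on it; now let `m` tend to infinity.
    refine tendsto_nhds_unique_of_eventuallyEq (lim μ) (lim ν) ?_
    filter_upwards [eventually_ge_atTop n] with m hm
    exact measure_eq_of_dependsUpTo ((hA.mono hm).inter (hD m)) fun x hx => h m x hx.2
  have := ext_of_generate_finite (μ := μ.restrict (⋂ n, D n)) (ν := ν.restrict (⋂ n, D n)) _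
    generateFrom_dependsUpTo isPiSystem_dependsUpTo (fun B ⟨n, hB⟩ => by
      rw [Measure.restrict_apply (measurableSet_of_dependsUpTo hB),
        Measure.restrict_apply (measurableSet_of_dependsUpTo hB)]
      exact key n B hB) (by
      have := key 0 Set.univ fun _ _ _ _ => trivial
      simpa using this)
  rw [← Measure.restrict_apply hA, ← Measure.restrict_apply hA, this]

lemma measure_ext_of_cone {μ ν : Measure (ℕ → S)} [IsFiniteMeasure μ] [IsFiniteMeasure ν]
    (h : ∀ n x, μ (cone n x) = ν (cone n x)) {A : Set (ℕ → S)} (hA : MeasurableSet A) :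
    μ A = ν A := by
  have := measure_inter_iInter_eq (D := fun _ => Set.univ) (fun _ _ _ _ _ => trivial)
    antitone_const (fun n x _ => h n x) hA
  simpa using this

end PathSpace

/-! ### The law of a chain: Markov property, simulation, recurrence. -/

namespace MarkovChain

variable {O S : Type} (M : MarkovChain O S)

/-- The chain with another initial state. -/
def startAt (s : S) : MarkovChain O S := { M with init := s }

@[simp] lemma startAt_init (s : S) : (M.startAt s).init = s := rfl
@[simp] lemma startAt_P (s : S) : (M.startAt s).P = M.P := rfl
lemma startAt_self : M.startAt M.init = M := rfl

lemma isMarkovKernel_stepKernel (n : ℕ) :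
    @IsMarkovKernel _ _ (@MeasurableSpace.pi _ _ fun _ => ⊤) ⊤ (M.stepKernel n) :=
  let _ : MeasurableSpace S := ⊤
  ⟨fun h => PMF.toMeasure.isProbabilityMeasure (M.P (h ⟨n, Finset.mem_Iic.2 le_rfl⟩))⟩

instance : IsProbabilityMeasure M.law := by
  let _ : MeasurableSpace S := ⊤
  have := M.isMarkovKernel_stepKernel
  unfold law
  infer_instance

lemma ae_init : ∀ᵐ ρ ∂M.law, ρ 0 = M.init := by
  let _ : MeasurableSpace S := ⊤
  have := M.isMarkovKernel_stepKernel
  have h := Kernel.traj_map_frestrictLe_apply (X := fun _ => S) (κ := M.stepKernel) 0 0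
    (fun _ => M.init)
  rw [Kernel.partialTraj_self, Kernel.id_apply] at h
  have hm : Measurable (fun y : (Finset.Iic 0 : Finset ℕ) → S => y ⟨0, Finset.mem_Iic.2 le_rfl⟩) :=
    measurable_pi_apply _
  have h2 : ∀ᵐ y ∂(Measure.dirac (fun _ : (Finset.Iic 0 : Finset ℕ) => M.init)),
      y ⟨0, Finset.mem_Iic.2 le_rfl⟩ = M.init := by
    exact (ae_dirac_iff (hm (MeasurableSpace.measurableSet_top (s := {M.init})))).2 rfl
  rw [← h] at h2
  exact ae_of_ae_map (Preorder.measurable_frestrictLe 0).aemeasurable h2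

/-- `t` can be reached from `s`. -/
def Reach (s t : S) : Prop := Relation.ReflTransGen (fun s t => t ∈ (M.P s).support) s t

open Classical in
lemma law_cone_zero (x : ℕ → S) : M.law (cone 0 x) = if x 0 = M.init then 1 else 0 := by
  split_ifs with h
  · rw [prob_compl_eq_zero_iff (measurableSet_cone 0 x) |>.symm]
    refine measure_mono_null ?_ M.ae_init
    intro ρ hρ h0
    exact hρ fun i hi => by rw [Nat.le_zero.1 hi, h0, h]
  · refine measure_mono_null ?_ M.ae_init
    intro ρ hρ h0
    exact h ((hρ 0 le_rfl).symm.trans h0)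

variable [Countable S]

/-- The one-step Markov property, read off from the composition-product description of the
trajectory kernel. Besides `ae_init` and total mass one, nothing else about that kernel is needed
later. -/
lemma law_inter_succ {n : ℕ} {A : Set (ℕ → S)} (hA : DependsUpTo n A) (B : Set S) (c : ℝ≥0∞)
    (hc : ∀ ρ ∈ A, (M.P (ρ n)).toOuterMeasure B = c) :
    M.law (A ∩ {ρ | ρ (n + 1) ∈ B}) = M.law A * c := by
  let _ : MeasurableSpace S := ⊤
  have := M.isMarkovKernel_stepKernel
  have h := Kernel.partialTraj_compProd_eq_map_traj (X := fun _ => S) (κ := M.stepKernel)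
    (Nat.zero_le n) (x₀ := fun _ => M.init)
  set A' := Preorder.frestrictLe (π := fun _ => S) n '' A
  have hpre : Preorder.frestrictLe (π := fun _ => S) n ⁻¹' A' = A := hA.preimage_image
  have hA' : MeasurableSet A' := (Set.to_countable A').measurableSet
  have hB : MeasurableSet B := MeasurableSpace.measurableSet_top
  have hfr := Preorder.measurable_frestrictLe (X := fun _ : ℕ => S) n
  have hmeas : Measurable (fun x : ℕ → S => (Preorder.frestrictLe (π := fun _ => S) n x, x (n + 1))) :=
    hfr.prodMk (measurable_pi_apply _)
  have h1 : M.law (A ∩ {ρ | ρ (n + 1) ∈ B}) =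
      (M.law.map (fun x : ℕ → S => (Preorder.frestrictLe (π := fun _ => S) n x, x (n + 1))))
        (A' ×ˢ B) := by
    rw [Measure.map_apply hmeas (hA'.prod hB)]
    congr 1
    conv_lhs => rw [← hpre]
    rfl
  have h2 : M.law A = Kernel.partialTraj (X := fun _ => S) M.stepKernel 0 n (fun _ => M.init) A' := by
    rw [← Kernel.traj_map_frestrictLe_apply, Measure.map_apply hfr hA', hpre]
    rfl
  rw [h1, h2]
  change (Measure.map _ (Kernel.traj (X := fun _ => S) M.stepKernel 0 (fun _ => M.init))) _ = _
  rw [← h, Measure.compProd_apply_prod hA' hB, mul_comm, ← setLIntegral_const]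
  refine setLIntegral_congr_fun hA' ?_
  rintro _ ⟨ρ, hρ, rfl⟩
  exact (PMF.toMeasure_apply_eq_toOuterMeasure_apply _ hB).trans (hc ρ hρ)

lemma ae_support : ∀ᵐ ρ ∂M.law, ∀ n, ρ (n + 1) ∈ (M.P (ρ n)).support := by
  refine ae_all_iff.2 fun n => ?_
  have h : ∀ s : S, ∀ᵐ ρ ∂M.law, ρ n = s → ρ (n + 1) ∈ (M.P s).support := fun s => by
    have := M.law_inter_succ (dependsUpTo_coord n {s}) (M.P s).supportᶜ 0 (by
      rintro ρ rfl
      rw [PMF.toOuterMeasure_apply_eq_zero_iff]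
      exact disjoint_compl_right)
    rw [mul_zero] at this
    refine measure_mono_null ?_ this
    intro ρ hρ
    simpa using hρ
  filter_upwards [ae_all_iff.2 h] with ρ hρ
  exact hρ _ rfl

lemma law_cone_succ (n : ℕ) (x : ℕ → S) :
    M.law (cone (n + 1) x) = M.law (cone n x) * M.P (x n) (x (n + 1)) := by
  rw [← M.law_inter_succ (dependsUpTo_cone n x) {x (n + 1)} _ fun ρ hρ => by
    rw [PMF.toOuterMeasure_apply_singleton, hρ n le_rfl]]
  congr 1
  ext ρ
  simp only [cone, Set.mem_inter_iff, Set.mem_ofPred_eq, Set.mem_singleton_iff, Nat.le_succ_iff]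
  constructor
  · exact fun h => ⟨fun i hi => h i (Or.inl hi), h _ (Or.inr rfl)⟩
  · rintro ⟨h, h'⟩ i (hi | rfl)
    exacts [h i hi, h']

/-- The Markov property at time `b`. -/
lemma law_inter_shift {b : ℕ} {A : Set (ℕ → S)} (hA : DependsUpTo b A) {s : S}
    (hs : ∀ ρ ∈ A, ρ b = s) {E : Set (ℕ → S)} (hE : MeasurableSet E) :
    M.law (A ∩ shift b ⁻¹' E) = M.law A * (M.startAt s).law E := by
  have hAm := measurableSet_of_dependsUpTo hA
  -- Cones suffice: both sides are finite measures in `E`, and those are determined by their values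
  -- on cones.
  have hcone : ∀ n x, M.law (A ∩ shift b ⁻¹' cone n x) = M.law A * (M.startAt s).law (cone n x) := by
    intro n x
    induction n with
    | zero =>
      rw [law_cone_zero, startAt_init]
      split_ifs with h
      · rw [mul_one]
        congr 1
        refine Set.inter_eq_left.2 fun ρ hρ i hi => ?_
        rw [Nat.le_zero.1 hi, shift_apply, add_zero, hs ρ hρ, h]
      · rw [mul_zero]
        convert measure_empty (μ := M.law)
        refine Set.eq_empty_of_forall_notMem fun ρ hρ => h ?_
        rw [← hρ.2 0 le_rfl, shift_apply, add_zero, hs ρ hρ.1]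
    | succ n ih =>
      rw [law_cone_succ, ← mul_assoc, ← ih, startAt_P]
      have hd : DependsUpTo (b + n) (A ∩ shift b ⁻¹' cone n x) :=
        (hA.mono (Nat.le_add_right _ _)).inter fun ρ ρ' e h i hi => by
          rw [shift_apply, ← e _ (by lia)]
          exact h i hi
      rw [← M.law_inter_succ hd {x (n + 1)} _ fun ρ hρ => by
        rw [PMF.toOuterMeasure_apply_singleton, ← hρ.2 n le_rfl, shift_apply]]
      congr 1
      ext ρ
      simp only [cone, Set.mem_inter_iff, Set.mem_preimage, Set.mem_ofPred_eq, shift_apply,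
        Set.mem_singleton_iff, Nat.le_succ_iff, and_assoc, add_assoc]
      refine and_congr_right fun _ => ⟨fun h => ⟨fun i hi => h i (Or.inl hi), h _ (Or.inr rfl)⟩, ?_⟩
      rintro ⟨h, h'⟩ i (hi | rfl)
      exacts [h i hi, h']
  have : IsFiniteMeasure (M.law A • (M.startAt s).law) :=
    Measure.smul_finite _ (measure_ne_top _ _)
  have := measure_ext_of_cone (μ := (M.law.restrict A).map (shift b))
    (ν := M.law A • (M.startAt s).law) (fun n x => by
      rw [Measure.map_apply (measurable_shift b) (measurableSet_cone n x), Measure.restrict_apply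
        (measurable_shift b (measurableSet_cone n x)), Set.inter_comm, hcone]
      rfl) hE
  rw [Measure.map_apply (measurable_shift b) hE, Measure.restrict_apply (measurable_shift b hE),
    Set.inter_comm] at this
  exact this

lemma measure_eq_tsum_coord (μ : Measure (ℕ → S)) (b : ℕ) {A : Set (ℕ → S)}
    (hA : MeasurableSet A) : μ A = ∑' s, μ (A ∩ {ρ | ρ b ∈ ({s} : Set S)}) := by
  rw [← measure_iUnion _ fun s => hA.inter (measurableSet_coord b {s}), ← Set.inter_iUnion]
  · congr 1
    ext ρ
    simp
  · intro s t hst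
    refine Set.disjoint_left.2 fun ρ h1 h2 => hst ?_
    rw [← show ρ b = s from h1.2, ← show ρ b = t from h2.2]

lemma law_inter_shift_le {b : ℕ} {A : Set (ℕ → S)} (hA : DependsUpTo b A) {C : Set S}
    (hC : ∀ ρ ∈ A, ρ b ∈ C) {E : Set (ℕ → S)} (hE : MeasurableSet E) {c : ℝ≥0∞}
    (hc : ∀ s ∈ C, (M.startAt s).law E ≤ c) :
    M.law (A ∩ shift b ⁻¹' E) ≤ c * M.law A := by
  rw [measure_eq_tsum_coord _ b ((measurableSet_of_dependsUpTo hA).inter (measurable_shift b hE)),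
    measure_eq_tsum_coord _ b (measurableSet_of_dependsUpTo hA), ← ENNReal.tsum_mul_left]
  refine ENNReal.tsum_le_tsum fun s => ?_
  rw [Set.inter_right_comm, M.law_inter_shift (hA.inter (dependsUpTo_coord b {s}))
    (fun ρ hρ => hρ.2) hE, mul_comm]
  by_cases hs : s ∈ C
  · gcongr
    exact hc s hs
  · have : A ∩ {ρ | ρ b ∈ ({s} : Set S)} = ∅ := ?_
    · rw [this, measure_empty, mul_zero, mul_zero]
    refine Set.eq_empty_of_forall_notMem fun ρ hρ => hs ?_
    rw [← show ρ b = s from hρ.2]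
    exact hC ρ hρ.1

/-- Induction backwards along a path from `s` to `t`: each step has positive probability, and by
`hshift` an occurrence of `E` after the step is an occurrence before it. -/
lemma law_pos_of_reach {s t : S} (h : M.Reach s t) {E : Set (ℕ → S)} (hE : MeasurableSet E)
    (hshift : ∀ ρ, shift 1 ρ ∈ E → ρ ∈ E) (hpos : 0 < (M.startAt t).law E) :
    0 < (M.startAt s).law E := by
  induction h using Relation.ReflTransGen.head_induction_on with
  | refl => exact hpos
  | @head s u hsu _ ih =>
    have h1 := (M.startAt s).law_inter_shift (dependsUpTo_coord 1 {u}) (fun ρ hρ => hρ) hE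
    have h2 := (M.startAt s).law_inter_succ (n := 0) (dependsUpTo_coord 0 {s}) {u}
      (M.P s u) (fun ρ hρ => by
        rw [PMF.toOuterMeasure_apply_singleton, startAt_P, show ρ 0 = s from hρ])
    have h3 : (M.startAt s).law {ρ | ρ 0 ∈ ({s} : Set S)} = 1 := by
      rw [← prob_compl_eq_zero_iff (measurableSet_coord 0 {s})]
      exact (M.startAt s).ae_init
    rw [h3, one_mul] at h2
    refine lt_of_lt_of_le (ENNReal.mul_pos ?_ ih.ne') (h1.symm.le.trans (measure_mono ?_))
    · refine ((pos_iff_ne_zero.2 ((PMF.mem_support_iff _ _).1 hsu)).trans_le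
        (h2.symm.le.trans (measure_mono Set.inter_subset_right))).ne'
    · exact fun ρ hρ => hshift ρ hρ.2

lemma ae_reach : ∀ᵐ ρ ∂M.law, ∀ m n, m ≤ n → M.Reach (ρ m) (ρ n) := by
  filter_upwards [M.ae_support] with ρ hρ m n hmn
  induction n, hmn using Nat.le_induction with
  | base => exact .refl
  | succ n _ ih => exact ih.tail (hρ n)

/-- A chain `N` follows `M` as long as it stays in `G`: its law on the event that this holds
forever is determined by `M`. -/
lemma law_simulation {S' : Type} [Countable S'] (N : MarkovChain O S') (φ : S' → S) (G : Set S')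
    (H : ℕ → (ℕ → S) → S') (hH : ∀ n x y, (∀ i ≤ n, x i = y i) → H n x = H n y)
    (hinit : φ N.init = M.init)
    (hstep : ∀ s' ∈ G, (N.P s').map φ = M.P (φ s'))
    (hrun : ∀ᵐ ρ ∂N.law, ∀ n, (∀ m < n, H m (φ ∘ ρ) ∈ G) → ρ n = H n (φ ∘ ρ))
    {B : Set (ℕ → S)} (hB : MeasurableSet B) :
    N.law {ρ | (∀ m, H m (φ ∘ ρ) ∈ G) ∧ φ ∘ ρ ∈ B} = M.law {x | (∀ m, H m x ∈ G) ∧ x ∈ B} := by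
  have hφ : Measurable (fun ρ : ℕ → S' => φ ∘ ρ) := measurable_map_path φ
  have : IsProbabilityMeasure (N.law.map fun ρ => φ ∘ ρ) :=
    Measure.isProbabilityMeasure_map hφ.aemeasurable
  -- `H m x` is the state of `N` at time `m` recovered from the projected path `x`. A cone of level
  -- `n` involves only the transitions out of times `m < n`, so only these must start in `G`.
  set D : ℕ → Set (ℕ → S) := fun n => {x | ∀ m < n, H m x ∈ G} with hD
  have hDm : ∀ n, DependsUpTo n (D n) := fun n x y e h m hm => by
    rw [← hH m x y fun i hi => e i (by lia)]
    exact h m hm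
  have hcone : ∀ n, ∀ x ∈ D n, (N.law.map fun ρ => φ ∘ ρ) (cone n x) = M.law (cone n x) := by
    intro n
    induction n with
    | zero =>
      intro x _
      rw [law_cone_zero, Measure.map_apply hφ (measurableSet_cone _ _)]
      split_ifs with h
      · rw [← prob_compl_eq_zero_iff (hφ (measurableSet_cone 0 x))]
        refine measure_mono_null ?_ N.ae_init
        intro ρ hρ h0
        refine hρ fun i hi => ?_
        rw [Nat.le_zero.1 hi, h, ← hinit, ← h0]
        rfl
      · refine measure_mono_null ?_ N.ae_init
        intro ρ hρ h0
        rw [← hinit, ← h0] at h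
        exact h (hρ 0 le_rfl).symm
    | succ n ih =>
      intro x hx
      have hx' : x ∈ D n := fun m hm => hx m (by lia)
      rw [law_cone_succ, ← ih x hx', Measure.map_apply hφ (measurableSet_cone _ _),
        Measure.map_apply hφ (measurableSet_cone _ _)]
      have e1 : N.law ((fun ρ => φ ∘ ρ) ⁻¹' cone n x) =
          N.law {ρ | ρ n = H n x ∧ φ ∘ ρ ∈ cone n x} := by
        refine measure_congr ?_
        filter_upwards [hrun] with ρ hρ
        refine propext ⟨fun h => ⟨?_, h⟩, fun h => h.2⟩
        have hc : ∀ m ≤ n, H m (φ ∘ ρ) = H m x := fun m hm => hH m _ _ fun i hi => h i (hi.trans hm)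
        rw [← hc n le_rfl]
        refine hρ n fun m hm => ?_
        rw [hc m hm.le]
        exact hx' m hm
      have e2 : N.law ((fun ρ => φ ∘ ρ) ⁻¹' cone (n + 1) x) =
          N.law ({ρ | ρ n = H n x ∧ φ ∘ ρ ∈ cone n x} ∩ {ρ | ρ (n + 1) ∈ φ ⁻¹' {x (n + 1)}}) := by
        refine measure_congr ?_
        filter_upwards [hrun] with ρ hρ
        refine propext ⟨fun h => ⟨⟨?_, fun i hi => h i (by lia)⟩, h (n + 1) le_rfl⟩, fun h i hi => ?_⟩
        · have hc : ∀ m ≤ n, H m (φ ∘ ρ) = H m x :=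
            fun m hm => hH m _ _ fun i hi => h i (by lia)
          rw [← hc n le_rfl]
          refine hρ n fun m hm => ?_
          rw [hc m hm.le]
          exact hx' m hm
        · rcases Nat.le_succ_iff.1 hi with hi | rfl
          exacts [h.1.2 i hi, h.2]
      rw [e1, e2]
      -- If the recovered state does not project to `x n`, the level-`n` cone is already null and
      -- both sides vanish.
      by_cases hne : φ (H n x) = x n
      · refine N.law_inter_succ ?_ _ _ ?_
        · rintro ρ ρ' e ⟨h1, h2⟩
          refine ⟨(e n le_rfl).symm.trans h1, fun i hi => ?_⟩
          rw [← h2 i hi, Function.comp, Function.comp, e i hi]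
        · rintro ρ ⟨h1, -⟩
          rw [← PMF.toOuterMeasure_map_apply, h1, hstep _ (hx n (Nat.lt_succ_self n)),
            PMF.toOuterMeasure_apply_singleton, hne]
      · have : {ρ : ℕ → S' | ρ n = H n x ∧ φ ∘ ρ ∈ cone n x} = ∅ :=
          Set.eq_empty_of_forall_notMem fun ρ hρ => hne (by rw [← hρ.1]; exact hρ.2 n le_rfl)
        rw [this, Set.empty_inter, measure_empty, zero_mul]
  have hDi : ∀ x, x ∈ ⋂ n, D n ↔ ∀ m, H m x ∈ G := fun x => by
    simp only [Set.mem_iInter, hD, Set.mem_ofPred_eq]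
    exact ⟨fun h m => h (m + 1) m (Nat.lt_succ_self m), fun h _ m _ => h m⟩
  have main := measure_inter_iInter_eq hDm (fun i j hij x hx m hm => hx m (hm.trans_le hij)) hcone hB
  have hDim : MeasurableSet (⋂ n, D n) :=
    MeasurableSet.iInter fun n => measurableSet_of_dependsUpTo (hDm n)
  rw [Measure.map_apply hφ (hB.inter hDim)] at main
  convert main using 2
  · ext ρ
    rw [Set.mem_preimage, Set.mem_inter_iff, hDi, and_comm]
    rfl
  · ext x
    rw [Set.mem_inter_iff, hDi, and_comm]
    rfl

/-- If from `R` the chain returns to `R` with probability at most `a < 1`, and the shift invariant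
event `E` forces a visit to `R`, then `E` is null. -/
lemma law_eq_zero_of_return_le (R : Set S) {a : ℝ≥0∞} (ha : a < 1)
    (hR : ∀ s ∈ R, (M.startAt s).law {ρ | ∃ t, ρ (t + 1) ∈ R} ≤ a)
    {E : Set (ℕ → S)} (hE : MeasurableSet E) (hshift : ∀ ρ b, ρ ∈ E → shift b ρ ∈ E)
    (hvisit : ∀ s, ∀ᵐ ρ ∂(M.startAt s).law, ρ ∈ E → ∃ t, ρ (t + 1) ∈ R) (s : S) :
    (M.startAt s).law E = 0 := by
  -- Splitting at the first visit to `R` after time `0` bounds the probability of `E` by `q` times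
  -- that of such a visit. For starts in `R` this gives `q ≤ q * a`, and `a < 1` forces `q = 0`.
  set q : ℝ≥0∞ := ⨆ s ∈ R, (M.startAt s).law E with hq
  have hle : ∀ s, (M.startAt s).law E ≤ q * (M.startAt s).law {ρ | ∃ t, ρ (t + 1) ∈ R} := by
    intro s
    set A : ℕ → Set (ℕ → S) := fun t => {ρ | ρ (t + 1) ∈ R ∧ ∀ u < t, ρ (u + 1) ∉ R} with hA
    have hAd : ∀ t, DependsUpTo (t + 1) (A t) := by
      rintro t ρ ρ' e ⟨h1, h2⟩
      refine ⟨by rwa [← e _ le_rfl], fun u hu => ?_⟩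
      rw [← e _ (by lia)]
      exact h2 u hu
    have hdisj : Pairwise (Function.onFun Disjoint A) := by
      intro t u htu
      refine Set.disjoint_left.2 fun ρ h1 h2 => ?_
      rcases lt_or_gt_of_ne htu with h | h
      · exact h2.2 t h h1.1
      · exact h1.2 u h h2.1
    have hun : {ρ : ℕ → S | ∃ t, ρ (t + 1) ∈ R} = ⋃ t, A t := by
      classical
      ext ρ
      simp only [Set.mem_ofPred_eq, Set.mem_iUnion, hA]
      constructor
      · intro h
        exact ⟨Nat.find h, Nat.find_spec h, fun u hu => Nat.find_min h hu⟩
      · rintro ⟨t, h, -⟩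
        exact ⟨t, h⟩
    rw [hun, measure_iUnion hdisj fun t => measurableSet_of_dependsUpTo (hAd t),
      ← ENNReal.tsum_mul_left]
    calc (M.startAt s).law E ≤ (M.startAt s).law (⋃ t, A t ∩ shift (t + 1) ⁻¹' E) := by
          refine measure_mono_ae ?_
          filter_upwards [hvisit s] with ρ hρ hρE
          have := hρ hρE
          have hmem : ρ ∈ {ρ : ℕ → S | ∃ t, ρ (t + 1) ∈ R} := this
          rw [hun] at hmem
          obtain ⟨t, ht⟩ := Set.mem_iUnion.1 hmem
          exact Set.mem_iUnion.2 ⟨t, ht, hshift ρ _ hρE⟩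
      _ ≤ ∑' t, (M.startAt s).law (A t ∩ shift (t + 1) ⁻¹' E) := measure_iUnion_le _
      _ ≤ _ := ENNReal.tsum_le_tsum fun t =>
          (M.startAt s).law_inter_shift_le (hAd t) (fun ρ hρ => hρ.1) hE
            fun u hu => le_iSup₂ (f := fun u (_ : u ∈ R) => (M.startAt u).law E) u hu
  have hq1 : q ≤ 1 := iSup₂_le fun _ _ => prob_le_one
  have hq0 : q = 0 := by
    have : q ≤ q * a := iSup₂_le fun s hs => (hle s).trans (by gcongr; exact hR s hs)
    by_contra h
    exact this.not_gt (by
      conv_rhs => rw [← mul_one q]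
      exact ENNReal.mul_lt_mul_right h (hq1.trans_lt ENNReal.one_lt_top).ne ha)
  have := hle s
  rwa [hq0, zero_mul, nonpos_iff_eq_zero] at this

end MarkovChain

/-! ### Hitting times in finite chains. -/

namespace MarkovChain

variable {O S : Type} (M : MarkovChain O S)

/-- A set of states that cannot be left. -/
def IsClosed (C : Set S) : Prop := ∀ s ∈ C, ∀ t, M.Reach s t → t ∈ C

/-- Finiteness of `S` gives one horizon `d` and one `a < 1` bounding the chance of missing `T` from
every state of `C`. Since `C` is closed, the bound applies afresh every `d` steps. -/
lemma exists_geometric_bound [Finite S] {C T : Set S} (hC : M.IsClosed C)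
    (hT : ∀ s ∈ C, ∃ t ∈ T, M.Reach s t) : ∃ d : ℕ, 0 < d ∧ ∃ a : ℝ≥0∞, a < 1 ∧ ∀ s ∈ C, ∀ m,
      (M.startAt s).law {ρ | ∀ i ≤ d * m, ρ i ∉ T} ≤ a ^ m := by
  classical
  have _ := Fintype.ofFinite S
  have hdep : ∀ n, DependsUpTo n {ρ : ℕ → S | ∀ i ≤ n, ρ i ∉ T} := fun n ρ ρ' e h i hi => by
    rw [← e i hi]
    exact h i hi
  have hpos : ∀ s ∈ C, ∃ n, (M.startAt s).law {ρ | ∀ i ≤ n, ρ i ∉ T} < 1 := by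
    intro s hs
    obtain ⟨t, ht, hst⟩ := hT s hs
    have h1 : 0 < (M.startAt s).law (⋃ n, {ρ | ρ n ∈ T}) := by
      refine M.law_pos_of_reach hst (MeasurableSet.iUnion fun n => measurableSet_coord n T) ?_ ?_
      · intro ρ hρ
        obtain ⟨n, hn⟩ := Set.mem_iUnion.1 hρ
        exact Set.mem_iUnion.2 ⟨1 + n, hn⟩
      · have : (M.startAt t).law (⋃ n, {ρ | ρ n ∈ T}) = 1 := by
          refine (prob_compl_eq_zero_iff
            (MeasurableSet.iUnion fun n => measurableSet_coord n T)).1 ?_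
          refine measure_mono_null ?_ (M.startAt t).ae_init
          intro ρ hρ h0
          refine hρ (Set.mem_iUnion.2 ⟨0, ?_⟩)
          rw [Set.mem_ofPred_eq, h0]
          exact ht
        rw [this]
        exact one_pos
    obtain ⟨n, hn⟩ := exists_measure_pos_of_not_measure_iUnion_null h1.ne'
    refine ⟨n, lt_of_le_of_ne prob_le_one fun h => hn.ne' ?_⟩
    rw [← prob_compl_eq_zero_iff (measurableSet_of_dependsUpTo (hdep n))] at h
    refine measure_mono_null ?_ h
    exact fun ρ hρ h' => h' n le_rfl hρ
  choose! N hN using hpos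
  -- The successor only makes `d` positive.
  set d := (Finset.univ.sup N) + 1 with hd
  set a : ℝ≥0∞ := Finset.univ.sup fun s => if s ∈ C then
    (M.startAt s).law {ρ | ∀ i ≤ d, ρ i ∉ T} else 0 with ha
  have ha' : ∀ s ∈ C, (M.startAt s).law {ρ | ∀ i ≤ d, ρ i ∉ T} ≤ a := fun s hs => by
    have := Finset.le_sup (f := fun s => if s ∈ C then
      (M.startAt s).law {ρ | ∀ i ≤ d, ρ i ∉ T} else 0) (Finset.mem_univ s)
    simpa only [if_pos hs] using this
  refine ⟨d, Nat.succ_pos _, a, ?_, ?_⟩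
  · refine (Finset.sup_lt_iff (by simp)).2 fun s _ => ?_
    split_ifs with hs
    · refine (measure_mono ?_).trans_lt (hN s hs)
      intro ρ hρ i hi
      refine hρ i (hi.trans ?_)
      exact (Finset.le_sup (f := N) (Finset.mem_univ s)).trans (Nat.le_succ _)
    · exact one_pos
  · intro s hs m
    induction m with
    | zero => simpa using prob_le_one
    | succ m ih =>
      have h1 := (M.startAt s).law_inter_shift_le (b := d * m) (C := C)
        ((hdep (d * m)).inter (dependsUpTo_coord (d * m) C)) (fun ρ hρ => hρ.2)
        (measurableSet_of_dependsUpTo (hdep d)) ha'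
      calc _ ≤ _ := measure_mono_ae ?_
        _ ≤ _ := h1
        _ ≤ a * a ^ m := by
          gcongr
          exact (measure_mono Set.inter_subset_left).trans ih
        _ = a ^ (m + 1) := (pow_succ' a m).symm
      filter_upwards [(M.startAt s).ae_init, (M.startAt s).ae_reach] with ρ h0 hr hρ
      refine ⟨⟨fun i hi => hρ i (by nlinarith), ?_⟩, fun i hi => hρ _ (by nlinarith)⟩
      exact hC s hs _ (by
        have := hr 0 (d * m) (Nat.zero_le _)
        rwa [h0] at this)

/-- Once the chain is in a closed set from which `T` is always reachable, it visits `T` within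
every window `[t, 2 t]`, up to finitely many exceptions. -/
lemma ae_eventually_window [Finite S] {C T : Set S} (hC : M.IsClosed C)
    (hT : ∀ s ∈ C, ∃ t ∈ T, M.Reach s t) :
    ∀ᵐ ρ ∂M.law, (∃ n, ρ n ∈ C) → ∃ N, ∀ t, N ≤ t → ∃ i, t ≤ i ∧ i ≤ 2 * t ∧ ρ i ∈ T := by
  obtain ⟨d, hd, a, ha, hbound⟩ := M.exists_geometric_bound hC hT
  have hB : ∀ t, M.law {ρ | ρ t ∈ C ∧ ∀ i, t ≤ i → i ≤ 2 * t → ρ i ∉ T} ≤ a ^ (t / d) := by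
    intro t
    have hdep : DependsUpTo (d * (t / d)) {ρ : ℕ → S | ∀ i ≤ d * (t / d), ρ i ∉ T} :=
      fun ρ ρ' e h i hi => by
        rw [← e i hi]
        exact h i hi
    have h1 := M.law_inter_shift_le (b := t) (dependsUpTo_coord t C) (fun ρ hρ => hρ)
      (measurableSet_of_dependsUpTo hdep) fun s hs => hbound s hs (t / d)
    have hle : d * (t / d) ≤ t := Nat.mul_div_le t d
    refine (measure_mono ?_).trans (h1.trans (mul_le_of_le_one_right' prob_le_one))
    exact fun ρ hρ => ⟨hρ.1, fun i hi => hρ.2 _ (by lia) (by lia)⟩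
  have hsum : ∑' t, M.law {ρ | ρ t ∈ C ∧ ∀ i, t ≤ i → i ≤ 2 * t → ρ i ∉ T} ≠ ∞ := by
    refine ne_top_of_le_ne_top ?_ (ENNReal.tsum_le_tsum hB)
    -- Each exponent `m` equals `t / d` for exactly `d` values of `t`, so the sum is `d` times a
    -- geometric series, and Borel–Cantelli applies.
    have : NeZero d := ⟨hd.ne'⟩
    rw [← (Nat.divModEquiv d).symm.tsum_eq, ENNReal.tsum_prod']
    have : ∀ m (r : Fin d), a ^ (((Nat.divModEquiv d).symm (m, r)) / d) = a ^ m := fun m r => by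
      have := congrArg Prod.fst ((Nat.divModEquiv d).apply_symm_apply (m, r))
      change _ = m at this
      conv_rhs => rw [← this]
      rfl
    simp only [this, tsum_fintype, Finset.sum_const, nsmul_eq_mul, Finset.card_univ,
      Fintype.card_fin, ENNReal.tsum_mul_left, ENNReal.tsum_geometric]
    refine ENNReal.mul_ne_top (ENNReal.natCast_ne_top d) (ENNReal.inv_ne_top.2 ?_)
    exact (tsub_pos_of_lt ha).ne'
  filter_upwards [ae_eventually_notMem hsum, M.ae_reach] with ρ hρ hr ⟨n, hn⟩
  obtain ⟨N, hN⟩ := eventually_atTop.1 hρ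
  refine ⟨max n N, fun t ht => ?_⟩
  have := hN t (le_trans (le_max_right _ _) ht)
  by_contra! hcon
  exact this ⟨hC _ hn _ (hr n t (le_trans (le_max_left _ _) ht)), fun i h1 h2 => hcon i h1 h2⟩

end MarkovChain

/-! ### Good windows and the Rabin condition. -/

/-- Some `e j` occurs in the window `[a, b]` while `f j` does not. -/
def GoodWindow {k : ℕ} (w : ℕ → Set (Marker k)) (a b : ℕ) : Prop :=
  ∃ j, (∃ i, a ≤ i ∧ i ≤ b ∧ Marker.e j ∈ w i) ∧ ∀ i, a ≤ i → i ≤ b → Marker.f j ∉ w i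

/-- The second half of the path is good after every positive number of blocks of length `2 * F`. -/
def goodBlocks (k F : ℕ) : Set (ℕ → Set (Marker k)) :=
  {w | ∀ b, 1 ≤ b → GoodWindow w (F * b) (2 * (F * b))}

lemma measurableSet_rabin (k : ℕ) : MeasurableSet (rabin k) := by
  simp only [rabin, ← Nat.frequently_atTop_iff_infinite, ← Set.not_infinite, frequently_atTop,
    Set.ofPred_exists, Set.ofPred_and, Set.ofPred_forall, not_forall, not_exists, not_and]
  refine MeasurableSet.iUnion fun j => MeasurableSet.inter ?_ ?_
  · exact MeasurableSet.iInter fun a => MeasurableSet.iUnion fun b =>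
      (MeasurableSet.const _).inter (measurableSet_coord b {s | Marker.e j ∈ s})
  · exact MeasurableSet.iUnion fun a => MeasurableSet.iInter fun b => MeasurableSet.iInter fun _ =>
      measurableSet_coord b {s | Marker.f j ∉ s}

namespace MarkovChain

variable {k : ℕ} {S : Type} [Finite S] (M : MarkovChain (Set (Marker k)) S)

/-- For every pair `j`, almost every run ends in one of three ways: the windows `[t, 2 t]` finally
all contain `e j`, and `f j` has ceased to occur; or `e j` has ceased to occur; or the windows
finally all contain `f j`. -/
lemma ae_trichotomy (j : Fin k) : ∀ᵐ ρ ∂M.law, ∃ N,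
    ((∀ t, N ≤ t → ∃ i, t ≤ i ∧ i ≤ 2 * t ∧ Marker.e j ∈ M.obs (ρ i)) ∧
      ∀ t, N ≤ t → Marker.f j ∉ M.obs (ρ t)) ∨
    (∀ t, N ≤ t → Marker.e j ∉ M.obs (ρ t)) ∨
    (∀ t, N ≤ t → ∃ i, t ≤ i ∧ i ≤ 2 * t ∧ Marker.f j ∈ M.obs (ρ i)) := by
  -- These closed sets replace an analysis of bottom strongly connected components. Their union is
  -- reachable from everywhere: outside `V` one can move to a `t` that cannot reach `f j`, and then
  -- either `U` is reachable from `t` or `t ∈ G`.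
  set G : Set S := {s | ∀ t, M.Reach s t → Marker.f j ∉ M.obs t ∧
    ∃ u ∈ {u | Marker.e j ∈ M.obs u}, M.Reach t u}
  set U : Set S := {s | ∀ t, M.Reach s t → Marker.e j ∉ M.obs t}
  set V : Set S := {s | ∀ t, M.Reach s t → ∃ u ∈ {u | Marker.f j ∈ M.obs u}, M.Reach t u}
  have hG : M.IsClosed G := fun s hs t hst u htu => hs u (hst.trans htu)
  have hV : M.IsClosed V := fun s hs t hst u htu => hs u (hst.trans htu)
  have hU : M.IsClosed U := fun s hs t hst u htu => hs u (hst.trans htu)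
  have hD : ∀ s ∈ Set.univ, ∃ t ∈ G ∪ (U ∪ V), M.Reach s t := by
    intro s _
    by_cases h : s ∈ V
    · exact ⟨s, Or.inr (Or.inr h), .refl⟩
    obtain ⟨t, hst, ht⟩ : ∃ t, M.Reach s t ∧ ∀ u ∈ {u | Marker.f j ∈ M.obs u}, ¬ M.Reach t u := by
      by_contra! hcon
      exact h hcon
    by_cases h' : ∃ u ∈ U, M.Reach t u
    · obtain ⟨u, hu, htu⟩ := h'
      exact ⟨u, Or.inr (Or.inl hu), hst.trans htu⟩
    · push Not at h'
      refine ⟨t, Or.inl fun u htu => ⟨fun hf => ht u hf htu, ?_⟩, hst⟩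
      by_contra! hcon
      exact h' u (fun v huv he => hcon v he huv) htu
  filter_upwards [M.ae_eventually_window (fun _ _ _ _ => trivial) hD,
    M.ae_eventually_window hG (fun s hs => (hs s .refl).2),
    M.ae_eventually_window hV (fun s hs => hs s .refl), M.ae_reach] with ρ h1 h2 h3 hr
  obtain ⟨N, hN⟩ := h1 ⟨0, trivial⟩
  obtain ⟨n, -, -, hn | hn | hn⟩ := hN N le_rfl
  · obtain ⟨N', hN'⟩ := h2 ⟨n, hn⟩
    exact ⟨max n N', Or.inl ⟨fun t ht => hN' t (le_trans (le_max_right _ _) ht), fun t ht =>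
      (hn _ (hr n t (le_trans (le_max_left _ _) ht))).1⟩⟩
  · exact ⟨n, Or.inr (Or.inl fun t ht => hn _ (hr n t ht))⟩
  · obtain ⟨N', hN'⟩ := h3 ⟨n, hn⟩
    exact ⟨N', Or.inr (Or.inr hN')⟩

/-- Outside the Rabin language the first alternative of `ae_trichotomy` fails for every `j`. There
are finitely many pairs, so one late window is bad for all of them at once. -/
lemma ae_rabin_of_goodBlocks : ∀ᵐ ρ ∂M.law, ∀ F, 1 ≤ F → M.obsSeq ρ ∈ goodBlocks k F →
    M.obsSeq ρ ∈ rabin k := by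
  filter_upwards [ae_all_iff.2 M.ae_trichotomy] with ρ hρ F hF hgood
  by_contra hcon
  choose N hN using hρ
  set b := Finset.univ.sup N + 1
  have hb : ∀ j, N j ≤ F * b := fun j =>
    ((Finset.le_sup (f := N) (Finset.mem_univ j)).trans (Nat.le_succ _)).trans
      (Nat.le_mul_of_pos_left _ hF)
  obtain ⟨j, ⟨i, hi1, hi2, he⟩, hf⟩ := hgood b (Nat.le_add_left _ _)
  rcases hN j with ⟨h1, h2⟩ | h | h
  · refine hcon ⟨j, ?_, ?_⟩
    · refine Nat.frequently_atTop_iff_infinite.1 (frequently_atTop.2 fun a => ?_)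
      obtain ⟨i, hi, -, he⟩ := h1 (max a (N j)) (le_max_right _ _)
      exact ⟨i, (le_max_left _ _).trans hi, he⟩
    · refine (Set.finite_Iio (N j)).subset fun i hi => ?_
      by_contra hlt
      exact h2 i (not_lt.1 hlt) hi
  · exact h i ((hb j).trans hi1) he
  · obtain ⟨i, hi1, hi2, hi⟩ := h _ (hb j)
    exact hf i hi1 hi2 hi

/-- The pair witnessing the Rabin condition must fall under the first alternative of
`ae_trichotomy`, whose threshold `N` serves all `F ≥ N`. The uniformity in `F` yields one success
probability for all rounds with large `f n`. -/
lemma exists_law_goodBlocks_pos (h : 0 < M.prob (rabin k)) :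
    ∃ N, 0 < M.law {ρ | ∀ F, N ≤ F → M.obsSeq ρ ∈ goodBlocks k F} := by
  by_contra! hcon
  refine h.ne' ?_
  have h0 : M.law (⋃ N, {ρ | ∀ F, N ≤ F → M.obsSeq ρ ∈ goodBlocks k F}) = 0 :=
    measure_iUnion_null fun N => nonpos_iff_eq_zero.1 (hcon N)
  refine measure_mono_null_ae ?_ h0
  filter_upwards [ae_all_iff.2 M.ae_trichotomy] with ρ hρ hR
  obtain ⟨j, he, hf⟩ : M.obsSeq ρ ∈ rabin k := hR
  obtain ⟨N, ⟨h1, h2⟩ | h | h⟩ := hρ j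
  · refine Set.mem_iUnion.2 ⟨N, fun F hF b hb => ⟨j, ?_, ?_⟩⟩
    · exact h1 _ (hF.trans (Nat.le_mul_of_pos_right _ hb))
    · exact fun i hi _ => h2 i ((hF.trans (Nat.le_mul_of_pos_right _ hb)).trans hi)
  · obtain ⟨i, hi, hi'⟩ := he.exists_gt N
    exact absurd hi (h i hi'.le)
  · obtain ⟨B, hB⟩ := hf.bddAbove
    obtain ⟨i, hi1, -, hi⟩ := h (max N (B + 1)) (le_max_left _ _)
    have := hB hi
    have := (le_max_right N (B + 1)).trans hi1
    lia

end MarkovChain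

/-! ### Histories of the restart process. -/

instance : Finite Action :=
  Finite.of_surjective (fun b : Bool => if b then Action.r else Action.c) fun a => by
    cases a
    exacts [⟨true, rfl⟩, ⟨false, rfl⟩]

section Histories

variable {S : Type}

/-- The number of restarts in a path of the restart process. -/
def Hist.count (π : Hist S Action) : ℕ := (π.1.map Prod.snd).count Action.r

/-- Nothing has been sampled since the last restart. -/
def Hist.Fresh (π : Hist S Action) : Prop := π.1 = [] ∨ ∃ l s, π.1 = l ++ [(s, Action.r)]

/-- The path `π` continued through the states `x` without restarts. -/
def Hist.extend (π : Hist S Action) (t : ℕ) (x : ℕ → S) : Hist S Action :=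
  (π.1 ++ (List.range t).map fun i => (x i, Action.c), x t)

lemma Hist.extend_succ (π : Hist S Action) (t : ℕ) (x : ℕ → S) :
    (π.extend (t + 1) x).1 = (π.extend t x).1 ++ [(x t, Action.c)] := by
  simp [Hist.extend, List.range_succ]

lemma Hist.count_extend (π : Hist S Action) (t : ℕ) (x : ℕ → S) :
    (π.extend t x).count = π.count := by
  induction t with
  | zero => simp [Hist.count, Hist.extend]
  | succ t ih =>
    rw [Hist.count, Hist.extend_succ, List.map_append, List.count_append, ← Hist.count, ih]
    simp

lemma restartCount_map {O : Type} (o : S → O) (l : List (S × Action)) :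
    restartCount (l.map fun x => (o x.1, x.2)) = (l.map Prod.snd).count Action.r := by
  simp [restartCount, Function.comp_def]

lemma currentPath_extend {O : Type} (o : S → O) {π : Hist S Action} (hπ : π.Fresh) (t : ℕ)
    (x : ℕ → S) : currentPath ((π.extend t x).1.map fun y => (o y.1, y.2)) (o (x t)) =
      (List.range (t + 1)).map fun i => o (x i) := by
  rw [List.range_succ, List.map_append, currentPath]
  congr 1
  induction t with
  | zero =>
    rcases hπ with h | ⟨l, s, h⟩
    · simp [Hist.extend, h]
    · simp [Hist.extend, h]
  | succ t ih =>
    rw [Hist.extend_succ, List.map_append, List.map_singleton, List.rtakeWhile_concat_pos _ _ _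
      (by simp), List.map_append, ih, List.range_succ, List.map_append]
    rfl

variable {k : ℕ}

lemma mem_drop_map_range {α : Type} (w : ℕ → α) (m n : ℕ) (a : α) :
    a ∈ ((List.range n).map w).drop m ↔ ∃ i, m ≤ i ∧ i < n ∧ w i = a := by
  rw [List.mem_drop_iff_getElem]
  simp only [List.length_map, List.length_range, List.getElem_map, List.getElem_range]
  constructor
  · rintro ⟨i, hi, rfl⟩
    exact ⟨_, by lia, by lia, rfl⟩
  · rintro ⟨i, h1, h2, rfl⟩
    exact ⟨i - m, by lia, by congr 1; lia⟩

lemma isGood_secondHalf_iff (hk : 1 ≤ k) (w : ℕ → Set (Marker k)) (m : ℕ) :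
    IsGood (secondHalf ((List.range (2 * m + 1)).map w)) ↔ m = 0 ∨ GoodWindow w m (2 * m) := by
  have hdrop : secondHalf ((List.range (2 * m + 1)).map w) =
      ((List.range (2 * m + 1)).map w).drop m := by
    rw [secondHalf, pathLength, List.length_map, List.length_range]
    congr 1
    lia
  have hlen : pathLength (((List.range (2 * m + 1)).map w).drop m) = 0 ↔ m = 0 := by
    rw [pathLength, List.length_drop, List.length_map, List.length_range]
    lia
  simp only [IsGood, IsGoodFor, hdrop, hlen, GoodWindow, exists_or,
    mem_drop_map_range]
  constructor
  · rintro (⟨-, h⟩ | ⟨j, ⟨_, ⟨i, h1, h2, rfl⟩, he⟩, hf⟩)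
    · exact Or.inl h
    · exact Or.inr ⟨j, ⟨i, h1, by lia, he⟩, fun i h1 h2 => hf _ ⟨i, h1, by lia, rfl⟩⟩
  · rintro (h | ⟨j, ⟨i, h1, h2, he⟩, hf⟩)
    -- Even a path of length `0` needs an index to be good, hence `1 ≤ k`.
    · exact Or.inl ⟨⟨0, hk⟩, h⟩
    · refine Or.inr ⟨j, ⟨_, ⟨i, h1, by lia, rfl⟩, he⟩, ?_⟩
      rintro _ ⟨i, h1, h2, rfl⟩
      exact hf i h1 (by lia)

end Histories

/-! ### Runs under the strategy, and the law of a round without restart. -/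

section Runs

variable {k : ℕ} {S : Type} (M : MarkovChain (Set (Marker k)) S) (f : ℕ → ℕ)

/-- The chain that the strategy induces on the restart process of `M`. -/
noncomputable abbrev testChain : MarkovChain (Set (Marker k)) (Hist S Action) :=
  M.restartMDP.induced (strategyS k f)

/-- The action chosen after the path `π`. -/
noncomputable abbrev testChoice (π : Hist S Action) : Action := M.restartMDP.choice (strategyS k f) π

/-- Every path in the sequence extends the one before by a move that is possible. -/
def IsTestRun (ρ : ℕ → Hist S Action) : Prop := ∀ t,
  (ρ (t + 1)).1 = (ρ t).1 ++ [((ρ t).2, testChoice M f (ρ t))] ∧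
    (ρ (t + 1)).2 ∈ (M.restartMDP.Δ (ρ t).2 (testChoice M f (ρ t))).support

lemma ae_isTestRun [Finite S] (π : Hist S Action) :
    ∀ᵐ ρ ∂((testChain M f).startAt π).law, IsTestRun M f ρ := by
  filter_upwards [((testChain M f).startAt π).ae_support] with ρ hρ t
  obtain ⟨s, hs, h⟩ := (PMF.mem_support_map_iff _ _ _).1 (hρ t)
  rw [← h]
  exact ⟨rfl, hs⟩

variable {M f}

lemma Action.ne_r {a : Action} : a ≠ Action.r ↔ a = Action.c := by cases a <;> simp

lemma strategyS_eq_c_iff (f : ℕ → ℕ) (h : List (Set (Marker k) × Action)) (o : Set (Marker k)) :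
    strategyS k f h o = Action.c ↔ f (restartCount h) ≠ 0 ∧
      (2 * f (restartCount h) ∣ pathLength (currentPath h o) →
        IsGood (secondHalf (currentPath h o))) := by
  unfold strategyS
  split_ifs with hc
  · refine iff_of_false nofun fun hr => ?_
    exact hc.elim hr.1 fun hc => hc.2 (hr.2 hc.1)
  · push Not at hc
    exact iff_of_true rfl hc

lemma testChoice_extend {π : Hist S Action} (hπ : π.Fresh) (t : ℕ) (x : ℕ → S) :
    testChoice M f (π.extend t x) = Action.c ↔ f π.count ≠ 0 ∧ (2 * f π.count ∣ t →
      IsGood (secondHalf ((List.range (t + 1)).map fun i => M.obs (x i)))) := by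
  have h1 : restartCount ((π.extend t x).1.map fun y => (M.obs y.1, y.2)) = π.count := by
    rw [restartCount_map, ← Hist.count_extend π t x]
    rfl
  have h2 := currentPath_extend M.obs hπ t x
  have h3 : pathLength ((List.range (t + 1)).map fun i => M.obs (x i)) = t := by
    simp [pathLength]
  have h4 := strategyS_eq_c_iff f ((π.extend t x).1.map fun y => (M.obs y.1, y.2)) (M.obs (x t))
  rw [h1, h2, h3] at h4
  exact h4

/-- Checks occur only at times `2 F b` with `F = f π.count`; the one at `b = 0` always succeeds
because its path has length `0`. -/
lemma testChoice_extend_forall (hk : 1 ≤ k) {π : Hist S Action} (hπ : π.Fresh) (x : ℕ → S) :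
    (∀ t, testChoice M f (π.extend t x) = Action.c) ↔
      f π.count ≠ 0 ∧ M.obsSeq x ∈ goodBlocks k (f π.count) := by
  simp only [testChoice_extend hπ, forall_and, forall_const]
  refine and_congr_right fun h0 => ⟨fun h b hb => ?_, ?_⟩
  · have := (isGood_secondHalf_iff hk _ _).1 (h (2 * (f π.count * b)) ⟨b, by ring⟩)
    exact this.resolve_left (Nat.mul_ne_zero h0 (by lia))
  · rintro h _ ⟨b, rfl⟩
    rw [mul_assoc, isGood_secondHalf_iff hk]
    rcases Nat.eq_zero_or_pos b with rfl | hb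
    · exact Or.inl (mul_zero _)
    · exact Or.inr (h b hb)

namespace IsTestRun

variable {ρ : ℕ → Hist S Action}

lemma shift (h : IsTestRun M f ρ) (b : ℕ) : IsTestRun M f (shift b ρ) := fun t => h (b + t)

lemma mem_restartSteps (h : IsTestRun M f ρ) (t : ℕ) :
    t ∈ restartSteps ρ ↔ testChoice M f (ρ t) = Action.r := by
  simp [restartSteps, (h t).1]

lemma notMem_restartSteps (h : IsTestRun M f ρ) (t : ℕ) :
    t ∉ restartSteps ρ ↔ testChoice M f (ρ t) = Action.c := by
  rw [h.mem_restartSteps, ← ne_eq, Action.ne_r]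

/-- Until a restart, the history is a function of the state sequence alone. The hypothesis speaks of
the reconstructed paths, as `law_simulation` requires. -/
lemma eq_extend (h : IsTestRun M f ρ) (n : ℕ)
    (hc : ∀ m < n, testChoice M f ((ρ 0).extend m (Prod.snd ∘ ρ)) = Action.c) :
    ρ n = (ρ 0).extend n (Prod.snd ∘ ρ) := by
  induction n with
  | zero => simp [Hist.extend]
  | succ n ih =>
    have ih := ih fun m hm => hc m (by lia)
    refine Prod.ext ?_ rfl
    rw [Hist.extend_succ, (h n).1, ← ih]
    congr 4
    rw [ih]
    exact hc n (Nat.lt_succ_self n)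

lemma restartSteps_eq_empty_iff (h : IsTestRun M f ρ) :
    restartSteps ρ = ∅ ↔ ∀ t, testChoice M f ((ρ 0).extend t (Prod.snd ∘ ρ)) = Action.c := by
  rw [Set.eq_empty_iff_forall_notMem]
  simp only [h.notMem_restartSteps]
  constructor
  · intro hc t
    induction t using Nat.strong_induction_on with
    | _ t ih =>
      rw [← h.eq_extend t ih]
      exact hc t
  · intro hc t
    rw [h.eq_extend t fun m _ => hc m]
    exact hc t

lemma count_succ (h : IsTestRun M f ρ) (t : ℕ) [Decidable (t ∈ restartSteps ρ)] :
    (ρ (t + 1)).count = (ρ t).count + if t ∈ restartSteps ρ then 1 else 0 := by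
  rw [Hist.count, (h t).1, List.map_append, List.count_append, ← Hist.count]
  congr 1
  split_ifs with hr
  · simp [(h.mem_restartSteps t).1 hr]
  · simp [(h.notMem_restartSteps t).1 hr]

lemma monotone_count (h : IsTestRun M f ρ) : Monotone fun t => (ρ t).count := by
  classical
  exact monotone_nat_of_le_succ fun t => by rw [h.count_succ]; exact Nat.le_add_right _ _

lemma fresh_succ (h : IsTestRun M f ρ) {t : ℕ} (ht : t ∈ restartSteps ρ) :
    (ρ (t + 1)).Fresh ∧ (ρ (t + 1)).2 = M.init := by
  rw [h.mem_restartSteps] at ht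
  refine ⟨Or.inr ⟨(ρ t).1, (ρ t).2, by rw [(h t).1, ht]⟩, ?_⟩
  have := (h t).2
  rw [ht] at this
  exact (PMF.mem_support_pure_iff _ _).1 this

/-- If there are infinitely many restarts, every large number occurs as the number of restarts
right after a restart. -/
lemma exists_restart_count (h : IsTestRun M f ρ) (hinf : (restartSteps ρ).Infinite) {n : ℕ}
    (hn : (ρ 0).count < n) : ∃ t ∈ restartSteps ρ, (ρ (t + 1)).count = n := by
  classical
  have hub : ∀ n, ∃ t, n ≤ (ρ t).count := by
    intro n
    induction n with
    | zero => exact ⟨0, Nat.zero_le _⟩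
    | succ n ih =>
      obtain ⟨t, ht⟩ := ih
      obtain ⟨u, hu, htu⟩ := hinf.exists_gt t
      refine ⟨u + 1, ?_⟩
      rw [h.count_succ, if_pos hu]
      exact Nat.succ_le_succ (ht.trans (h.monotone_count htu.le))
  -- At the first time the count reaches `n` it equals `n` and the preceding step is a restart,
  -- since it grows by at most one per step.
  have hspec := Nat.find_spec (hub n)
  have hmin := fun m => Nat.find_min (hub n) (m := m)
  obtain ⟨t, ht⟩ : ∃ t, Nat.find (hub n) = t + 1 := Nat.exists_eq_succ_of_ne_zero fun h0 => by
    rw [h0] at hspec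
    lia
  rw [ht] at hspec
  have hlt := hmin t (by lia)
  have hc := h.count_succ t
  by_cases hr : t ∈ restartSteps ρ
  · rw [if_pos hr] at hc
    exact ⟨t, hr, by lia⟩
  · rw [if_neg hr] at hc
    lia

/-- A run with finitely many restarts has a last restart, unless it has none. -/
lemma exists_tailStart (h : IsTestRun M f ρ) (h0 : ρ 0 = ([], M.init))
    (hfin : (restartSteps ρ).Finite) : (ρ (tailStart ρ)).Fresh ∧ (ρ (tailStart ρ)).2 = M.init ∧
      restartSteps (BlackBoxTesting.shift (tailStart ρ) ρ) = ∅ := by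
  rcases (restartSteps ρ).eq_empty_or_nonempty with he | hne
  · have hz : tailStart ρ = 0 := by simp [tailStart, he]
    rw [hz, h0]
    refine ⟨Or.inl rfl, rfl, ?_⟩
    convert he using 2
    ext1 i
    rw [shift_apply, zero_add]
  · obtain ⟨u, hu, hmax⟩ := hfin.exists_maximal hne
    have hz : tailStart ρ = u + 1 := by
      refine IsGreatest.csSup_eq ⟨⟨u, hu, rfl⟩, ?_⟩
      rintro _ ⟨v, hv, rfl⟩
      have := hmax hv
      lia
    rw [hz]
    refine ⟨(h.fresh_succ hu).1, (h.fresh_succ hu).2, Set.eq_empty_of_forall_notMem fun v hv => ?_⟩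
    have : u + 1 + v ∈ restartSteps ρ := hv
    have := hmax this
    lia

end IsTestRun

lemma mem_restartSteps_shift (ρ : ℕ → Hist S Action) (b t : ℕ) :
    t ∈ restartSteps (shift b ρ) ↔ b + t ∈ restartSteps ρ := Iff.rfl

lemma infinite_restartSteps_shift (ρ : ℕ → Hist S Action) (b : ℕ) :
    (restartSteps (shift b ρ)).Infinite ↔ (restartSteps ρ).Infinite := by
  constructor
  · intro h
    exact (h.image (f := fun t => b + t) (fun _ _ _ _ e => by simpa using e)).mono
      (by rintro _ ⟨t, ht, rfl⟩; exact ht)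
  · intro h
    refine Set.infinite_of_forall_exists_gt fun a => ?_
    obtain ⟨u, hu, hau⟩ := h.exists_gt (b + a)
    refine ⟨u - b, ?_, by lia⟩
    rwa [mem_restartSteps_shift, Nat.add_sub_cancel' (by lia)]

lemma measurableSet_mem_restartSteps (t : ℕ) :
    MeasurableSet {ρ : ℕ → Hist S Action | t ∈ restartSteps ρ} :=
  measurableSet_coord (t + 1) {π : Hist S Action | ∃ s, π.1.getLast? = some (s, Action.r)}

lemma measurableSet_restartSteps_infinite :
    MeasurableSet {ρ : ℕ → Hist S Action | (restartSteps ρ).Infinite} := by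
  have : {ρ : ℕ → Hist S Action | (restartSteps ρ).Infinite} =
      ⋂ a : ℕ, ⋃ b : ℕ, ⋃ _ : a ≤ b, {ρ | b ∈ restartSteps ρ} := by
    ext ρ
    simp only [Set.mem_ofPred_eq, Set.mem_iInter, Set.mem_iUnion, exists_prop]
    rw [← frequently_atTop, Nat.frequently_atTop_iff_infinite]
    rfl
  rw [this]
  exact MeasurableSet.iInter fun a => MeasurableSet.iUnion fun b => MeasurableSet.iUnion fun _ =>
    measurableSet_mem_restartSteps b

lemma measurableSet_restartSteps_eq_empty :
    MeasurableSet {ρ : ℕ → Hist S Action | restartSteps ρ = ∅} := by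
  have : {ρ : ℕ → Hist S Action | restartSteps ρ = ∅} = ⋂ t, {ρ | t ∈ restartSteps ρ}ᶜ := by
    ext ρ
    simp [Set.eq_empty_iff_forall_notMem]
  rw [this]
  exact MeasurableSet.iInter fun t => (measurableSet_mem_restartSteps t).compl

/-- After a restart, the law of the run on the event that there is no further restart is that of
the runs of `M` all of whose sampled second halves are good. -/
lemma law_no_restart [Finite S] (hk : 1 ≤ k) {π : Hist S Action} (hπ : π.Fresh)
    (hinit : π.2 = M.init) {B : Set (ℕ → S)} (hB : MeasurableSet B) :
    ((testChain M f).startAt π).law {ρ | restartSteps ρ = ∅ ∧ Prod.snd ∘ ρ ∈ B} =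
      M.law {x | (f π.count ≠ 0 ∧ M.obsSeq x ∈ goodBlocks k (f π.count)) ∧ x ∈ B} := by
  -- The projection is the current state, `G` the histories where the strategy continues, and
  -- `π.extend` recovers the history from the states.
  have := M.law_simulation ((testChain M f).startAt π) Prod.snd
    {π | testChoice M f π = Action.c} π.extend (fun n x y e => by
      refine Prod.ext ?_ (e n le_rfl)
      refine congrArg (π.1 ++ ·) (List.map_congr_left fun i hi => ?_)
      rw [e i (List.mem_range.1 hi).le]) hinit (fun π' hπ' => by
      change PMF.map _ (PMF.map _ (M.restartMDP.Δ _ (testChoice M f π'))) = _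
      rw [show testChoice M f π' = Action.c from hπ', PMF.map_comp]
      exact PMF.map_id _) (by
      filter_upwards [ae_isTestRun M f π, ((testChain M f).startAt π).ae_init] with ρ hρ h0 n hn
      rw [MarkovChain.startAt_init] at h0
      rw [← h0] at hn ⊢
      exact hρ.eq_extend n hn) hB
  simp only [Set.mem_ofPred_eq, testChoice_extend_forall hk hπ] at this
  rw [← this]
  refine measure_congr ?_
  filter_upwards [ae_isTestRun M f π, ((testChain M f).startAt π).ae_init] with ρ hρ h0
  rw [MarkovChain.startAt_init] at h0
  refine propext (and_congr_left fun _ => ?_)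
  rw [hρ.restartSteps_eq_empty_iff, h0]
  exact testChoice_extend_forall hk hπ _

end Runs

/-! ### Unbounded `f`: the strategy is testing. -/

lemma limsup_eq_top_iff (f : ℕ → ℕ) :
    limsup (fun n => (f n : ℕ∞)) atTop = ⊤ ↔ ∀ B a : ℕ, ∃ n, a ≤ n ∧ B ≤ f n := by
  constructor
  · intro h B a
    have h1 : ((B : ℕ) : ℕ∞) < limsup (fun n => (f n : ℕ∞)) atTop := by
      rw [h]
      exact ENat.natCast_lt_top B
    obtain ⟨n, hn, hB⟩ := frequently_atTop.1 (frequently_lt_of_lt_limsup (by isBoundedDefault) h1) a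
    exact ⟨n, hn, (Nat.cast_lt.1 hB).le⟩
  · intro h
    refine ENat.eq_top_iff_forall_ge.2 fun B => ?_
    refine le_limsup_of_frequently_le (frequently_atTop.2 fun a => ?_) (by isBoundedDefault)
    obtain ⟨n, hn, hB⟩ := h B a
    exact ⟨n, hn, Nat.cast_le.2 hB⟩

theorem isTestingStrategy_of_unbounded {k : ℕ} (hk : 1 ≤ k) {f : ℕ → ℕ}
    (hf : ∀ B a : ℕ, ∃ n, a ≤ n ∧ B ≤ f n) : IsTestingStrategy (strategyS k f) (rabin k) := by
  intro S _ M hM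
  obtain ⟨N, hN⟩ := M.exists_law_goodBlocks_pos hM
  set p := M.law {ρ | ∀ F, N ≤ F → M.obsSeq ρ ∈ goodBlocks k F} with hp
  -- Starts of rounds with large parameter; `N + 1` rather than `N` ensures that it is nonzero. The
  -- last conjunct excludes the empty history, which is also fresh, so that a later visit to `R`
  -- witnesses a restart.
  set R : Set (Hist S Action) := {π | π.Fresh ∧ π.2 = M.init ∧ N + 1 ≤ f π.count ∧
    ∃ s, π.1.getLast? = some (s, Action.r)}
  have hreturn : ∀ π ∈ R, ((testChain M f).startAt π).law {ρ | ∃ t, ρ (t + 1) ∈ R} ≤ 1 - p := by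
    rintro π ⟨h1, h2, h3, -⟩
    have hlaw := law_no_restart (f := f) hk h1 h2 MeasurableSet.univ
    simp only [Set.mem_univ, and_true] at hlaw
    have hple : p ≤ ((testChain M f).startAt π).law {ρ | restartSteps ρ = ∅} := by
      rw [hlaw]
      exact measure_mono fun x hx => ⟨by lia, hx _ (by lia)⟩
    calc _ ≤ ((testChain M f).startAt π).law {ρ | restartSteps ρ = ∅}ᶜ := by
          refine measure_mono ?_
          rintro ρ ⟨t, -, -, -, ht⟩ h
          exact Set.eq_empty_iff_forall_notMem.1 h t ht
      _ = 1 - ((testChain M f).startAt π).law {ρ | restartSteps ρ = ∅} :=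
          prob_compl_eq_one_sub measurableSet_restartSteps_eq_empty
      _ ≤ 1 - p := tsub_le_tsub_left hple 1
  have hinf : ∀ π, ((testChain M f).startAt π).law {ρ | (restartSteps ρ).Infinite} = 0 := by
    refine (testChain M f).law_eq_zero_of_return_le R
      (ENNReal.sub_lt_self ENNReal.one_ne_top one_ne_zero hN.ne') hreturn
      measurableSet_restartSteps_infinite
      (fun ρ b h => (infinite_restartSteps_shift ρ b).2 h) fun π => ?_
    filter_upwards [ae_isTestRun M f π] with ρ hρ h
    obtain ⟨n, hn, hfn⟩ := hf (N + 1) ((ρ 0).count + 1)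
    obtain ⟨t, ht, hc⟩ := hρ.exists_restart_count h hn
    exact ⟨t, (hρ.fresh_succ ht).1, (hρ.fresh_succ ht).2, by rwa [hc], ht⟩
  set E : Set (ℕ → Hist S Action) := {ρ | restartSteps ρ = ∅ ∧
    Prod.snd ∘ ρ ∈ {x | M.obsSeq x ∈ rabin k}ᶜ}
  have hBm : MeasurableSet {x | M.obsSeq x ∈ rabin k}ᶜ :=
    (measurable_map_path M.obs (measurableSet_rabin k)).compl
  have hEm : MeasurableSet E :=
    measurableSet_restartSteps_eq_empty.inter (measurable_map_path Prod.snd hBm)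
  -- The start of the tail is random, so the bad event is shown null for each fixed `t` and the
  -- countably many times are combined.
  have hE : ∀ t, (testChain M f).law ({ρ | ρ t ∈ {π : Hist S Action | π.Fresh ∧ π.2 = M.init}} ∩
      shift t ⁻¹' E) = 0 := by
    intro t
    have := (testChain M f).law_inter_shift_le (dependsUpTo_coord t
      {π : Hist S Action | π.Fresh ∧ π.2 = M.init}) (fun ρ hρ => hρ) hEm (c := 0) fun π hπ => by
        rw [law_no_restart hk hπ.1 hπ.2 hBm]
        refine (measure_mono_null_ae ?_ measure_empty).le
        filter_upwards [M.ae_rabin_of_goodBlocks] with x hx h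
        exact h.2 (hx _ (Nat.one_le_iff_ne_zero.2 h.1.1) h.1.2)
    simpa using this
  have h1 := hinf (testChain M f).init
  rw [MarkovChain.startAt_self] at h1
  have h2 := ae_isTestRun M f (testChain M f).init
  rw [MarkovChain.startAt_self] at h2
  filter_upwards [measure_eq_zero_iff_ae_notMem.1 h1, h2, (testChain M f).ae_init,
    ae_all_iff.2 fun t => measure_eq_zero_iff_ae_notMem.1 (hE t)] with ρ hinf hrun h0 hnull
  have hfin : (restartSteps ρ).Finite := Set.not_infinite.1 hinf
  refine ⟨Set.encard_lt_top_iff.2 hfin, ?_⟩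
  obtain ⟨t1, t2, t3⟩ := hrun.exists_tailStart h0 hfin
  by_contra hcon
  exact hnull (tailStart ρ) ⟨⟨t1, t2⟩, t3, hcon⟩

/-! ### Bounded `f`: a chain that defeats the strategy. -/

/-- The chain on `0, …, L` that in every step stays or moves up with probability one half each, and
shows the markers `e j` in its last state only. -/
noncomputable def climbingChain (k L : ℕ) : MarkovChain (Set (Marker k)) (Fin (L + 1)) where
  init := 0
  obs s := {m | s = Fin.last L ∧ ∃ j, m = Marker.e j}
  P s := (PMF.uniformOfFintype Bool).map fun b =>
    if b then s else ⟨min (s.1 + 1) L, by lia⟩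

lemma mem_support_climbingChain (k L : ℕ) (s t : Fin (L + 1)) :
    t ∈ ((climbingChain k L).P s).support ↔ t = s ∨ t.1 = min (s.1 + 1) L := by
  rw [climbingChain, PMF.mem_support_map_iff]
  simp [PMF.support_uniformOfFintype, Fin.ext_iff, eq_comm, or_comm]

lemma climbingChain_prob_rabin_pos {k : ℕ} (hk : 1 ≤ k) (L : ℕ) :
    0 < (climbingChain k L).prob (rabin k) := by
  set M := climbingChain k L
  have hreach : ∀ n : ℕ, ∀ h : n < L + 1, M.Reach 0 ⟨n, h⟩ := by
    intro n
    induction n with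
    | zero => exact fun _ => .refl
    | succ n ih =>
      refine fun h => (ih (by lia)).tail ((mem_support_climbingChain k L _ _).2 (Or.inr ?_))
      simp only
      lia
  refine M.law_pos_of_reach (hreach L (Nat.lt_succ_self L))
    (measurable_map_path M.obs (measurableSet_rabin k)) ?_ ?_
  · rintro ρ ⟨j, he, hf⟩
    refine ⟨j, ?_, ?_⟩
    · refine (he.image (f := fun t => 1 + t) (fun _ _ _ _ e => by simpa using e)).mono ?_
      rintro _ ⟨t, ht, rfl⟩
      exact ht
    · refine Set.Finite.subset (Set.finite_empty) fun t ht => ?_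
      obtain ⟨-, i, hi⟩ := ht
      cases hi
  · have : ∀ᵐ ρ ∂(M.startAt ⟨L, Nat.lt_succ_self L⟩).law,
        ρ ∈ (fun (ρ : ℕ → Fin (L + 1)) i => M.obs (ρ i)) ⁻¹' rabin k := by
      filter_upwards [(M.startAt ⟨L, Nat.lt_succ_self L⟩).ae_init,
        (M.startAt ⟨L, Nat.lt_succ_self L⟩).ae_support] with ρ h0 hs
      have hL : ∀ t, ρ t = Fin.last L := by
        intro t
        induction t with
        | zero => exact h0
        | succ t ih =>
          have := (mem_support_climbingChain k L _ _).1 (hs t)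
          rw [ih] at this
          rcases this with h | h
          · exact h
          · exact Fin.ext (h.trans (min_eq_right (Nat.le_succ L)))
      refine ⟨⟨0, hk⟩, ?_, ?_⟩
      · convert Set.infinite_univ (α := ℕ)
        exact Set.eq_univ_of_forall fun t => ⟨hL t, _, rfl⟩
      · refine Set.Finite.subset (Set.finite_empty) fun t ht => ?_
        obtain ⟨-, i, hi⟩ := ht
        cases hi
    rw [pos_iff_ne_zero]
    intro hz
    have h := measure_eq_zero_iff_ae_notMem.1 hz
    obtain ⟨ρ, h1, h2⟩ := (this.and h).exists
    exact h2 h1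

/-- If no marker `e j` is seen in the first block after a restart, there is another restart. -/
lemma IsTestRun.exists_restart {k : ℕ} (hk : 1 ≤ k) {S : Type} {M : MarkovChain (Set (Marker k)) S}
    {f : ℕ → ℕ} {ρ : ℕ → Hist S Action} (h : IsTestRun M f ρ) {t : ℕ} (ht : (ρ t).Fresh)
    (he : ∀ i ≤ 2 * f (ρ t).count, (∀ u < t + i, t ≤ u → u ∉ restartSteps ρ) →
      ∀ j, Marker.e j ∉ M.obs (ρ (t + i)).2) :
    ∃ u ∈ restartSteps ρ, t ≤ u := by
  by_contra! hcon
  have hemp : restartSteps (BlackBoxTesting.shift t ρ) = ∅ :=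
    Set.eq_empty_of_forall_notMem fun u hu => (hcon _ hu).not_ge (Nat.le_add_right _ _)
  rw [(h.shift t).restartSteps_eq_empty_iff, testChoice_extend_forall hk (by exact ht)] at hemp
  obtain ⟨j, ⟨i, -, hi, hj⟩, -⟩ := hemp.2 1 le_rfl
  rw [mul_one] at hi
  exact he i hi (fun u _ htu hu => (hcon u hu).not_ge htu) j hj

theorem not_isTestingStrategy_of_bounded {k : ℕ} (hk : 1 ≤ k) {f : ℕ → ℕ} {B a : ℕ}
    (hf : ∀ n, a ≤ n → f n < B) : ¬ IsTestingStrategy (strategyS k f) (rabin k) := by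
  intro htest
  -- A first block has length `2 * f n < 2 * B` once `n ≥ a`, too short to reach the top.
  set M := climbingChain k (2 * B)
  set N := testChain M f
  have hpos := climbingChain_prob_rabin_pos hk (2 * B)
  have hB : 0 < B := Nat.zero_lt_of_lt (hf a le_rfl)
  have hobs0 : ∀ s : Fin (2 * B + 1), s.1 < 2 * B → ∀ j : Fin k, Marker.e j ∉ M.obs s := by
    rintro s hs j ⟨h, -⟩
    rw [h] at hs
    exact lt_irrefl _ hs
  -- the history in which the chain never leaves its initial state
  let h : ℕ → Hist (Fin (2 * B + 1)) Action := fun t =>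
    Nat.rec ([], 0) (fun _ π => (π.1 ++ [(π.2, testChoice M f π)], 0)) t
  have hh2 : ∀ t, (h t).2 = 0 := fun t => by cases t <;> rfl
  have hrun : IsTestRun M f h := by
    intro t
    refine ⟨rfl, ?_⟩
    rw [hh2 (t + 1), hh2 t]
    rcases testChoice M f (h t) with _ | _
    · exact (PMF.mem_support_pure_iff _ _).2 rfl
    · exact (mem_support_climbingChain k _ _ _).2 (Or.inl rfl)
  -- Early rounds may have large parameters, but a chain resting at `0` shows no marker and fails
  -- these too. Only a finite prefix of this history is needed, and that has positive probability.
  have hcount : ∀ n, ∃ t, (h t).Fresh ∧ n ≤ (h t).count := by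
    classical
    intro n
    induction n with
    | zero => exact ⟨0, Or.inl rfl, Nat.zero_le _⟩
    | succ n ih =>
      obtain ⟨t, ht, hn⟩ := ih
      obtain ⟨u, hu, htu⟩ := hrun.exists_restart hk ht fun i _ _ =>
        hobs0 _ (by rw [hh2]; exact Nat.mul_pos two_pos hB)
      refine ⟨u + 1, (hrun.fresh_succ hu).1, ?_⟩
      rw [hrun.count_succ, if_pos hu]
      exact Nat.succ_le_succ (hn.trans (hrun.monotone_count htu))
  obtain ⟨T, hT, hTa⟩ := hcount a
  have hreach : ∀ t, N.Reach N.init (h t) := by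
    intro t
    induction t with
    | zero => exact .refl
    | succ t ih =>
      refine ih.tail ((PMF.mem_support_map_iff _ _ _).2 ⟨_, (hrun t).2, ?_⟩)
      exact Prod.ext (hrun t).1.symm rfl
  have hinf : ∀ᵐ ρ ∂(N.startAt (h T)).law, (restartSteps ρ).Infinite := by
    filter_upwards [ae_isTestRun M f (h T), (N.startAt (h T)).ae_init] with ρ hρ h0
    have h0 : ρ 0 = h T := h0
    have hmore : ∀ t, (ρ t).Fresh → (ρ t).2 = 0 → ∃ u ∈ restartSteps ρ, t ≤ u := by
      intro t ht ht0
      refine hρ.exists_restart hk ht fun i hi hno => hobs0 _ ?_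
      have hB' : f (ρ t).count < B := hf _ <| hTa.trans <| by
        rw [← h0]
        exact hρ.monotone_count (Nat.zero_le t)
      -- The height grows by at most one per step, so it stays below `2 * B` throughout the block.
      suffices ∀ m ≤ i, (ρ (t + m)).2.1 ≤ m from (this i le_rfl).trans_lt (by lia)
      intro m
      induction m with
      | zero => simp [ht0]
      | succ m ih =>
        intro hm
        have hc := (hρ.notMem_restartSteps (t + m)).1 (hno _ (by lia) (by lia))
        have hs := (hρ (t + m)).2
        rw [hc] at hs
        have := ih (by lia)
        rcases (mem_support_climbingChain k _ _ _).1 hs with h | h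
        · rw [← add_assoc, h]
          lia
        · rw [← add_assoc, h]
          lia
    refine Set.infinite_of_forall_exists_gt fun b => ?_
    induction b with
    | zero =>
      obtain ⟨u, hu, -⟩ := hmore 0 (h0 ▸ hT) (h0 ▸ hh2 T)
      -- The first restart may be at time `0`, whereas a time strictly greater than `0` is wanted.
      obtain ⟨v, hv, huv⟩ := hmore _ (hρ.fresh_succ hu).1 (hρ.fresh_succ hu).2
      exact ⟨v, hv, by lia⟩
    | succ b ih =>
      obtain ⟨u, hu, hbu⟩ := ih
      obtain ⟨v, hv, huv⟩ := hmore _ (hρ.fresh_succ hu).1 (hρ.fresh_succ hu).2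
      exact ⟨v, hv, by lia⟩
  have hone : 0 < (N.startAt (h T)).law {ρ | (restartSteps ρ).Infinite} := by
    rw [pos_iff_ne_zero]
    intro hz
    obtain ⟨ρ, h1, h2⟩ := (hinf.and (measure_eq_zero_iff_ae_notMem.1 hz)).exists
    exact h2 h1
  refine (N.law_pos_of_reach (hreach T) measurableSet_restartSteps_infinite
    (fun ρ => (infinite_restartSteps_shift ρ 1).1) hone).ne' ?_
  rw [MarkovChain.startAt_self, measure_eq_zero_iff_ae_notMem]
  filter_upwards [htest _ M hpos] with ρ hρ hi
  exact hi (Set.encard_lt_top_iff.1 hρ.1)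

end BlackBoxTesting

theorem mainTheorem1 (k : ℕ) (hk : 1 ≤ k) (f : ℕ → ℕ) :
    BlackBoxTesting.IsTestingStrategy (BlackBoxTesting.strategyS k f) (BlackBoxTesting.rabin k) ↔
      Filter.limsup (fun n => (f n : ℕ∞)) Filter.atTop = ⊤ := by
  rw [BlackBoxTesting.limsup_eq_top_iff]
  refine ⟨fun h B a => ?_, BlackBoxTesting.isTestingStrategy_of_unbounded hk⟩
  by_contra! hcon
  exact BlackBoxTesting.not_isTestingStrategy_of_bounded hk hcon h
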